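/- Let $L,N_{st},N_p\ge 1$ be integers, $N=N_{st}N_p$, and let $\rho_{st},\rho_p\in[0,1)$. Put $\alpha_{st}=\frac{N_p\rho_{st}}{1-\rho_{st}}$ and $\alpha_p=\frac{N_{st}\rho_p}{1-\rho_p}$. Let $\mathbf y_1,\dots,\mathbf y_L\in\mathbb C^{N}$, and let $\mathbf Y_l\in\mathbb C^{N_p\times N_{st}}$ be the matrix whose columns, stacked on top of one another, give $\mathbf y_l$. Let $\mathbf r_{j,l}\in\mathbb C^{N_{st}}$ denote the (transposed, not conjugated) $j$th row and $\mathbf c_{i,l}\in\mathbb C^{N_p}$ the $i$th column of $\mathbf Y_l$. For Hermitian positive definite $\mathbf R_{st}\in\mathbb C^{N_{st}\times N_{st}}$ and $\mathbf R_p\in\mathbb C^{N_p\times N_p}$ define the penalized negative log-likelihood $$\mathcal L(\mathbf R_{st},\mathbf R_p)=\frac{N_p}{1-\rho_{st}}\log\det\mathbf R_{st}+\frac{N_{st}}{1-\rho_p}\log\det\mathbf R_p+\frac NL\sum_{l=1}^L\log\mathbf y_l^{\mathrm H}(\mathbf R_{st}\otimes\mathbf R_p)^{-1}\mathbf y_l+\alpha_{st}\mathrm{Tr}(\mathbf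 R_{st}^{-1})+\alpha_p\mathrm{Tr}(\mathbf R_p^{-1}).$$ Suppose that (1) none of the vectors $\mathbf r_{j,l}$ and $\mathbf c_{i,l}$ is zero; (2) there are $\beta_1,\beta_2\in[0,1]$ with $\beta_1+\beta_2=1$ such that, for every subspace $\{0\}\ne\mathcal S_{st}\subsetneq\mathbb C^{N_{st}}$, $$\beta_1 LN\,P_{LN_p}(\mathcal S_{st})<(LN_p+\alpha_{st}L)\dim\mathcal S_{st}-\beta_2LN,$$ and, for every subspace $\{0\}\ne\mathcal S_p\subsetneq\mathbb C^{N_p}$, $$\beta_2 LN\,P_{LN_{st}}(\mathcal S_p)<(LN_{st}+\alpha_pL)\dim\mathcal S_p-\beta_1LN,$$ where $P_{LN_p}(\mathcal S_{st})=\frac{1}{LN_p}\#\{(j,l):\mathbf r_{j,l}\in\mathcal S_{st}\}$ and $P_{LN_{st}}(\mathcal S_p)=\frac{1}{LN_{st}}\#\{(i,l):\mathbf c_{i,l}\in\mathcal S_p\}$. Then $\mathcal L$ is bounded below on the set of pairs of Hermitian positive definite matrices, and there is a pair $(\mathbf R_{st},\mathbf R_p)$ of Hermitian positive definite matrices that satisfies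 the fixed-point equations (the stationarity conditions of $\mathcal L$) $$\mathbf R_{st}=(1-\rho_{st})\frac{N_{st}}{L}\sum_{l=1}^L\frac{\big(\mathbf Y_l^{\mathrm H}\mathbf R_p^{-1}\mathbf Y_l\big)^{\mathrm T}}{\mathbf y_l^{\mathrm H}(\mathbf R_{st}^{-1}\otimes\mathbf R_p^{-1})\mathbf y_l}+\rho_{st}\mathbf I_{N_{st}},$$ $$\mathbf R_p=(1-\rho_p)\frac{N_p}{L}\sum_{l=1}^L\frac{\mathbf Y_l(\mathbf R_{st}^{-1})^{\mathrm T}\mathbf Y_l^{\mathrm H}}{\mathbf y_l^{\mathrm H}(\mathbf R_{st}^{-1}\otimes\mathbf R_p^{-1})\mathbf y_l}+\rho_p\mathbf I_{N_p}.$$ -/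

import Mathlib

open scoped Kronecker ComplexOrder Matrix

namespace RSKE

noncomputable section

/-- The `Np × Nst` matrix `Y` with `vec Y = y` (columns stacked). A vector of length `N = Nst * Np`
is indexed by pairs `(i, j)`, in the order of the Kronecker product `Rst ⊗ₖ Rp`: the pair `(i, j)`
(counted from `0`) stands for the position `Np * i + j`. -/
def unvec {Nst Np : ℕ} (y : Fin Nst × Fin Np → ℂ) : Matrix (Fin Np) (Fin Nst) ℂ :=
  Matrix.of fun j i => y (i, j)

/-- The hermitian form `yᴴ M y`. -/
def quadForm {ι : Type*} [Fintype ι] (M : Matrix ι ι ℂ) (y : ι → ℂ) : ℂ :=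
  star y ⬝ᵥ (M *ᵥ y)

/-- The penalty weight `α = M ρ / (1 - ρ)`, with `M = Np` for the space-time factor and
`M = Nst` for the polarization factor. -/
def penaltyWeight (M : ℕ) (ρ : ℝ) : ℝ := M * ρ / (1 - ρ)

/-- The penalized negative log-likelihood. The determinants, traces and hermitian forms in it are
real for positive definite arguments. -/
def cost {L Nst Np : ℕ} (ρst ρp : ℝ) (y : Fin L → Fin Nst × Fin Np → ℂ)
    (Rst : Matrix (Fin Nst) (Fin Nst) ℂ) (Rp : Matrix (Fin Np) (Fin Np) ℂ) : ℝ :=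
  (Np : ℝ) / (1 - ρst) * Real.log Rst.det.re
    + (Nst : ℝ) / (1 - ρp) * Real.log Rp.det.re
    + ((Nst * Np : ℕ) : ℝ) / L * ∑ l, Real.log (quadForm (Rst ⊗ₖ Rp)⁻¹ (y l)).re
    + penaltyWeight Np ρst * (Rst⁻¹).trace.re
    + penaltyWeight Nst ρp * (Rp⁻¹).trace.re

/-- The pair of fixed-point equations obtained by equating to zero the derivatives of `cost` with
respect to `Rst` and to `Rp`. With `yₗ = vec Yₗ`, the form `yₗᴴ (Rst⁻¹ ⊗ Rp⁻¹) yₗ` equals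
`Tr (Rp⁻¹ Yₗ (Rst⁻¹)ᵀ Yₗᴴ)`, which is where the transposes come from. -/
def IsFixedPoint {L Nst Np : ℕ} (ρst ρp : ℝ) (y : Fin L → Fin Nst × Fin Np → ℂ)
    (Rst : Matrix (Fin Nst) (Fin Nst) ℂ) (Rp : Matrix (Fin Np) (Fin Np) ℂ) : Prop :=
  Rst = ((1 - (ρst : ℂ)) * ((Nst : ℂ) / L)) •
        ∑ l, (quadForm (Rst⁻¹ ⊗ₖ Rp⁻¹) (y l))⁻¹ •
          ((unvec (y l))ᴴ * Rp⁻¹ * unvec (y l))ᵀ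
      + (ρst : ℂ) • (1 : Matrix (Fin Nst) (Fin Nst) ℂ) ∧
  Rp = ((1 - (ρp : ℂ)) * ((Np : ℂ) / L)) •
        ∑ l, (quadForm (Rst⁻¹ ⊗ₖ Rp⁻¹) (y l))⁻¹ •
          (unvec (y l) * (Rst⁻¹)ᵀ * (unvec (y l))ᴴ)
      + (ρp : ℂ) • (1 : Matrix (Fin Np) (Fin Np) ℂ)

open Classical in
/-- The fraction of the `L * Np` rows of the matrices `Yₗ` that lie in `S`. -/
def rowFraction {L Nst Np : ℕ} (y : Fin L → Fin Nst × Fin Np → ℂ)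
    (S : Submodule ℂ (Fin Nst → ℂ)) : ℝ :=
  (∑ j : Fin Np, ∑ l : Fin L, if (unvec (y l)).row j ∈ S then (1 : ℝ) else 0) / (L * Np)

open Classical in
/-- The fraction of the `L * Nst` columns of the matrices `Yₗ` that lie in `S`. -/
def colFraction {L Nst Np : ℕ} (y : Fin L → Fin Nst × Fin Np → ℂ)
    (S : Submodule ℂ (Fin Np → ℂ)) : ℝ :=
  (∑ i : Fin Nst, ∑ l : Fin L, if (unvec (y l)).col i ∈ S then (1 : ℝ) else 0) / (L * Nst)

/-- The inequality `P < ((L M + α L) d - β' L N) / (β L N)`, with the denominator cleared: for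
`β = 0` it says that the numerator on the right is positive. -/
def SpreadBound (L N M d : ℕ) (α β β' P : ℝ) : Prop :=
  β * L * N * P < (L * M + α * L) * d - β' * L * N

end

end RSKE

/-! In the precision matrices A = Rst⁻¹, B = Rp⁻¹ the likelihood is a functional J(A, B)
(`precisionCost`). A minimizer of J over all positive definite pairs gives both conclusions: its
value is the lower bound, and its first-order conditions in A and in B are the two fixed-point
equations. So the task is to show that the minimum is attained.

Degrees of homogeneity balance so that rescaling A or B to trace equal to its size never increases J
(`exists_rescale_factorCost_le`). On normalized pairs only a vanishing least eigenvalue can break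
compactness, so it suffices that J ≥ -ε₁ log a - ε₂ log b - C, where a, b are the least eigenvalues
(`precisionCost_coercive`).

To decouple the factors, a share β₁ of each term log yᴴ(A ⊗ B)y is bounded below using B ≥ b·1,
which leaves log b and the mean over rows of log rᴴAr; the share β₂ is treated symmetrically with
columns and log a. The log a from the columns joins the functional of A, and the log b from the rows
that of B. This crossing explains the terms β₂LN and β₁LN in the spread conditions.

For one factor (`factor_coercive`), let a₀ ≤ a₁ ≤ … be the eigenvalues. A vector r at a definite
distance from the span of the first k eigenvectors has rᴴAr ≥ η² a_k. The data vectors near that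
span themselves span a space of dimension at most k, with a threshold independent of the eigenbasis,
so the spread condition limits their number. Summation by parts then gives each gap log a_k - log
a_{k-1} a coefficient of at least ε, and the gaps add up to at least -log a₀, because the trace
normalization makes the largest eigenvalue at least 1. -/

namespace RSKE

/-! ### Summation by parts over spectral gaps -/

/-- Summation by parts against the gaps of a monotone sequence: the count of indices `t` that fail
`far t k` is controlled by `M * k`, and `X t` dominates `x k` whenever `far t k` holds. -/
lemma gap_sum_bound {T : Type*} [Fintype T] (far : T → ℕ → Prop) [∀ t k, Decidable (far t k)]
    (x : ℕ → ℝ) (X : T → ℝ) {M w b κ ε : ℝ} (hw : 0 ≤ w) (n : ℕ)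
    (hx : ∀ k < n, x k ≤ x (k + 1)) (hfar : ∀ t, far t 0)
    (hX : ∀ t, ∀ k ≤ n, far t k → x k ≤ X t)
    (hcount : ∀ k, 1 ≤ k → k ≤ n →
      w * (∑ t, if far t k then (0 : ℝ) else 1) + b + ε ≤ M * k)
    (htot : w * Fintype.card T + b = M * (n + 1) - κ) :
    -κ * x n + ε * (x n - x 0) ≤
      -M * ∑ i ∈ Finset.range (n + 1), x i + w * ∑ t, X t + b * x 0 := by
  have single : ∀ t, x 0 + ∑ k ∈ Finset.range n,
      (if far t (k + 1) then x (k + 1) - x k else 0) ≤ X t := by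
    intro t
    -- `far t` is not assumed antitone in `k`. The second bound keeps the partial sum below `x j`,
    -- so that each new index with `far t (j + 1)` restarts the comparison with `X t`.
    have aux : ∀ j ≤ n,
        (x 0 + ∑ k ∈ Finset.range j, (if far t (k + 1) then x (k + 1) - x k else 0) ≤ X t) ∧
        (x 0 + ∑ k ∈ Finset.range j, (if far t (k + 1) then x (k + 1) - x k else 0) ≤ x j) := by
      intro j
      induction j with
      | zero => intro _; simpa using hX t 0 (Nat.zero_le n) (hfar t)
      | succ j ih =>
        intro hj
        obtain ⟨h1, h2⟩ := ih (by omega)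
        have h3 := hx j (by omega)
        rw [Finset.sum_range_succ]
        split_ifs with h
        · have := hX t (j + 1) hj h
          constructor <;> linarith
        · constructor <;> linarith
    exact (aux n le_rfl).1
  have hsum : ∑ t, X t ≥ Fintype.card T * x 0 + ∑ k ∈ Finset.range n,
      (Fintype.card T - ∑ t, if far t (k + 1) then (0 : ℝ) else 1) * (x (k + 1) - x k) := by
    refine le_trans (le_of_eq ?_) (Finset.sum_le_sum fun t _ => single t)
    rw [Finset.sum_add_distrib, Finset.sum_comm]
    simp only [Finset.sum_const, Finset.card_univ, nsmul_eq_mul]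
    congr 1
    refine Finset.sum_congr rfl fun k _ => ?_
    have : (Fintype.card T : ℝ) = ∑ _t : T, (1 : ℝ) := by simp
    rw [this, ← Finset.sum_sub_distrib, Finset.sum_mul]
    refine Finset.sum_congr rfl fun t _ => ?_
    split_ifs <;> simp
  have habel : ∀ j : ℕ, ∑ i ∈ Finset.range (j + 1), x i =
      (j + 1) * x j - ∑ k ∈ Finset.range j, ((k : ℝ) + 1) * (x (k + 1) - x k) := by
    intro j
    induction j with
    | zero => simp
    | succ j ih =>
      rw [Finset.sum_range_succ, ih, Finset.sum_range_succ _ j]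
      push_cast
      ring
  have htel : ∑ k ∈ Finset.range n, (x (k + 1) - x k) = x n - x 0 := Finset.sum_range_sub x n
  have hgap : ∑ k ∈ Finset.range n, (w * (∑ t, if far t (k + 1) then (0 : ℝ) else 1) + b + ε) *
      (x (k + 1) - x k) ≤ ∑ k ∈ Finset.range n, M * ((k : ℝ) + 1) * (x (k + 1) - x k) := by
    refine Finset.sum_le_sum fun k hk => ?_
    have hk := Finset.mem_range.1 hk
    refine mul_le_mul_of_nonneg_right ?_ (by linarith [hx k hk])
    have := hcount (k + 1) (by omega) (by omega)
    push_cast at this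
    exact this
  have e1 : ∑ k ∈ Finset.range n, (w * (∑ t, if far t (k + 1) then (0 : ℝ) else 1) + b + ε) *
      (x (k + 1) - x k) = w * ∑ k ∈ Finset.range n,
        (∑ t, if far t (k + 1) then (0 : ℝ) else 1) * (x (k + 1) - x k)
        + (b + ε) * (x n - x 0) := by
    rw [← htel, Finset.mul_sum, Finset.mul_sum, ← Finset.sum_add_distrib]
    exact Finset.sum_congr rfl fun k _ => by ring
  have e2 : ∑ k ∈ Finset.range n,
      (Fintype.card T - ∑ t, if far t (k + 1) then (0 : ℝ) else 1) * (x (k + 1) - x k) =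
      Fintype.card T * (x n - x 0) - ∑ k ∈ Finset.range n,
        (∑ t, if far t (k + 1) then (0 : ℝ) else 1) * (x (k + 1) - x k) := by
    rw [← htel, Finset.mul_sum, ← Finset.sum_sub_distrib]
    exact Finset.sum_congr rfl fun k _ => by ring
  have e3 : ∑ k ∈ Finset.range n, M * ((k : ℝ) + 1) * (x (k + 1) - x k) =
      M * ∑ k ∈ Finset.range n, ((k : ℝ) + 1) * (x (k + 1) - x k) := by
    rw [Finset.mul_sum]
    exact Finset.sum_congr rfl fun k _ => by ring
  rw [habel n]
  rw [e1, e3] at hgap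
  rw [e2] at hsum
  have hs := mul_le_mul_of_nonneg_left hsum hw
  -- Once everything is written in `x n` and the gaps, `κ` is what remains of the total degree: its
  -- negative is the coefficient of `x n`.
  have hκ : κ = M * (n + 1) - w * Fintype.card T - b := by linarith
  subst hκ
  linarith

/-! ### Thresholds and margins uniform over subspaces -/

/-- A finite family of positive numbers has a common positive lower bound. -/
lemma exists_pos_le_of_finite {ι : Type*} [Finite ι] (p : ι → Prop) (f : ι → ℝ)
    (hf : ∀ i, p i → 0 < f i) : ∃ ε > 0, ∀ i, p i → ε ≤ f i := by
  classical
  cases nonempty_fintype ι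
  rcases isEmpty_or_nonempty ι with h | h
  · exact ⟨1, one_pos, fun i => h.elim i⟩
  · obtain ⟨i, hi⟩ := Finite.exists_min (fun i => if p i then f i else 1)
    refine ⟨if p i then f i else 1, ?_, fun j hj => ?_⟩
    · split_ifs with h
      · exact hf i h
      · exact one_pos
    · simpa [hj] using hi j

/-- Linearly independent subfamilies of a finite family stay independent under small
perturbations, so their size is bounded by the dimension of any subspace they are close to. -/
lemma exists_close_card_le_finrank {E T : Type*} [NormedAddCommGroup E] [NormedSpace ℂ E]
    [FiniteDimensional ℂ E] [Finite T] (r : T → E) :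
    ∃ δ > 0, ∀ W : Set T, LinearIndepOn ℂ r W → ∀ V : Submodule ℂ E,
      (∀ t ∈ W, ∃ v ∈ V, ‖r t - v‖ < δ) → W.ncard ≤ Module.finrank ℂ V := by
  have key : ∀ W : Set T, ∃ δ > 0, LinearIndepOn ℂ r W → ∀ V : Submodule ℂ E,
      (∀ t ∈ W, ∃ v ∈ V, ‖r t - v‖ < δ) → W.ncard ≤ Module.finrank ℂ V := by
    intro W
    by_cases hW : LinearIndepOn ℂ r W
    · cases nonempty_fintype W
      obtain ⟨δ, hδ, hball⟩ := Metric.isOpen_iff.1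
        -- Linear independence is an open condition on families, which gives a radius depending on
        -- `W` but not on `V`.
        (isOpen_setOfPred_linearIndependent (𝕜 := ℂ) (E := E) (ι := W)) (fun t => r t) hW
      refine ⟨δ, hδ, fun _ V hV => ?_⟩
      choose! v hv hrv using hV
      have hli : LinearIndependent ℂ (fun t : W => v t) := by
        apply hball
        rw [Metric.mem_ball, dist_pi_lt_iff hδ]
        intro t
        rw [dist_comm, dist_eq_norm]
        exact hrv t t.2
      have hli' : LinearIndependent ℂ (fun t : W => (⟨v t, hv t t.2⟩ : V)) :=
        LinearIndependent.of_comp V.subtype hli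
      rw [← Nat.card_coe_set_eq, Nat.card_eq_fintype_card]
      exact hli'.fintype_card_le_finrank
    · exact ⟨1, one_pos, fun h => absurd h hW⟩
  -- `T` has finitely many subsets, so the least of their radii serves all of them.
  choose d hd hkey using key
  obtain ⟨δ, hδ, hle⟩ := exists_pos_le_of_finite (fun _ : Set T => True) d fun W _ => hd W
  refine ⟨δ, hδ, fun W hW V hV => hkey W hW V fun t ht => ?_⟩
  obtain ⟨v, hv, h⟩ := hV t ht
  exact ⟨v, hv, h.trans_le (hle W trivial)⟩

/-- Unitary diagonalization with increasing eigenvalues. -/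
lemma exists_unitary_diagonal_monotone {n : ℕ} {A : Matrix (Fin n) (Fin n) ℂ}
    (hA : A.IsHermitian) :
    ∃ U ∈ Matrix.unitaryGroup (Fin n) ℂ, ∃ a : Fin n → ℝ, Monotone a ∧
      A = U * Matrix.diagonal (fun i => (a i : ℂ)) * Uᴴ := by
  let σ := Tuple.sort hA.eigenvalues
  let U : Matrix (Fin n) (Fin n) ℂ := hA.eigenvectorUnitary
  have hU : U * Uᴴ = 1 := Matrix.mem_unitaryGroup_iff.1 hA.eigenvectorUnitary.2
  refine ⟨U.submatrix id σ, ?_, hA.eigenvalues ∘ σ, Tuple.monotone_sort _, ?_⟩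
  · rw [Matrix.mem_unitaryGroup_iff, Matrix.star_eq_conjTranspose, Matrix.conjTranspose_submatrix,
      Matrix.submatrix_mul_equiv, hU, Matrix.submatrix_id_id]
  · have hd : Matrix.diagonal (fun i => (((hA.eigenvalues ∘ σ) i : ℝ) : ℂ)) =
        (Matrix.diagonal (fun i => (hA.eigenvalues i : ℂ))).submatrix σ σ := by
      rw [Matrix.submatrix_diagonal_equiv]
      rfl
    rw [hd, Matrix.conjTranspose_submatrix, Matrix.submatrix_mul_equiv,
      Matrix.submatrix_mul_equiv, Matrix.submatrix_id_id]
    have := hA.spectral_theorem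
    rw [Unitary.conjStarAlgAut_apply] at this
    exact this

/-- Vectors of a finite family that are close to a subspace `V` span a space of dimension at most
`dim V`, with a closeness threshold independent of `V`. -/
lemma exists_close_finrank_span_le {E T : Type*} [NormedAddCommGroup E] [NormedSpace ℂ E]
    [FiniteDimensional ℂ E] [Finite T] (r : T → E) :
    ∃ δ > 0, ∀ (W : Set T) (V : Submodule ℂ E), (∀ t ∈ W, ∃ v ∈ V, ‖r t - v‖ < δ) →
      Module.finrank ℂ (Submodule.span ℂ (r '' W)) ≤ Module.finrank ℂ V := by
  obtain ⟨δ, hδ, h⟩ := exists_close_card_le_finrank r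
  refine ⟨δ, hδ, fun W V hV => ?_⟩
  classical
  cases nonempty_fintype T
  obtain ⟨B, hBW, -, hspan, hli⟩ :=
    exists_linearIndepOn_extension (linearIndepOn_empty ℂ r) (Set.empty_subset W)
  have hle : Submodule.span ℂ (r '' W) ≤ Submodule.span ℂ (r '' B) := Submodule.span_le.2 hspan
  refine (Submodule.finrank_mono hle).trans (le_trans ?_ (h B hli V fun t ht => hV t (hBW ht)))
  refine (finrank_span_le_card (r '' B)).trans ?_
  rw [← Set.ncard_eq_toFinset_card']
  exact Set.ncard_image_le (Set.toFinite B)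

open Classical in
/-- The strict spread inequalities hold with a uniform margin. -/
lemma exists_uniform_margin {n : ℕ} {T : Type*} [Fintype T] (r : T → Fin n → ℂ)
    (hr : ∀ t, r t ≠ 0) {M w b : ℝ} (hM : 0 ≤ M) (hw : 0 ≤ w)
    (hS : ∀ S : Submodule ℂ (Fin n → ℂ), S ≠ ⊥ → S ≠ ⊤ →
      w * (∑ t, if r t ∈ S then (1 : ℝ) else 0) + b < M * Module.finrank ℂ S) :
    ∃ ε > 0, ∀ k : ℕ, 1 ≤ k → k < n → ∀ U : Finset T,
      Module.finrank ℂ (Submodule.span ℂ (r '' (U : Set T))) ≤ k →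
      w * U.card + b + ε ≤ M * k := by
  have strict : ∀ k : ℕ, 1 ≤ k → k < n → ∀ U : Finset T,
      Module.finrank ℂ (Submodule.span ℂ (r '' (U : Set T))) ≤ k →
      w * U.card + b < M * k := by
    intro k hk hkn U hU
    have general : ∀ S : Submodule ℂ (Fin n → ℂ), S ≠ ⊥ → Module.finrank ℂ S ≤ k →
        (∀ t ∈ U, r t ∈ S) → w * U.card + b < M * k := by
      intro S hS0 hSk hUS
      have hS1 : S ≠ ⊤ := by
        rintro rfl
        simp at hSk
        omega
      have hcard : (U.card : ℝ) ≤ ∑ t, if r t ∈ S then (1 : ℝ) else 0 := by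
        rw [Finset.sum_boole]
        exact_mod_cast Finset.card_le_card fun t ht => by simpa using hUS t ht
      have h1 := hS S hS0 hS1
      have h2 : M * Module.finrank ℂ S ≤ M * k :=
        mul_le_mul_of_nonneg_left (by exact_mod_cast hSk) hM
      have h3 := mul_le_mul_of_nonneg_left hcard hw
      linarith
    -- A zero span forces `U` to be empty, as no `r t` vanishes. The spread inequality excludes `⊥`,
    -- so any line replaces the span; its dimension 1 is at most `k`.
    by_cases hbot : Submodule.span ℂ (r '' (U : Set T)) = ⊥
    · let e : Fin n → ℂ := Pi.single ⟨0, by omega⟩ 1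
      have he : e ≠ 0 := by simp [e]
      refine general (Submodule.span ℂ {e}) (by simpa using he)
        ((finrank_span_singleton he).le.trans hk) fun t ht => ?_
      have : r t ∈ Submodule.span ℂ (r '' (U : Set T)) :=
        Submodule.subset_span ⟨t, ht, rfl⟩
      rw [hbot, Submodule.mem_bot] at this
      exact absurd this (hr t)
    · exact general _ hbot hU fun t ht => Submodule.subset_span ⟨t, ht, rfl⟩
  obtain ⟨ε, hε, h⟩ := exists_pos_le_of_finite
    (fun p : Fin n × Finset T => 1 ≤ (p.1 : ℕ) ∧
      Module.finrank ℂ (Submodule.span ℂ (r '' (p.2 : Set T))) ≤ p.1)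
    (fun p => M * (p.1 : ℕ) - w * p.2.card - b)
    (fun p hp => by linarith [strict p.1 hp.1 p.1.2 p.2 hp.2])
  refine ⟨ε, hε, fun k hk hkn U hU => ?_⟩
  have := h (⟨k, hkn⟩, U) ⟨hk, hU⟩
  simp only at this
  linarith

/-! ### Eigenbasis estimates and coercivity in one factor -/

/-- The Hermitian form of a unitarily diagonalized matrix. -/
lemma quadForm_unitary_diagonal {n : ℕ} (U : Matrix (Fin n) (Fin n) ℂ) (a : Fin n → ℝ)
    (r : Fin n → ℂ) :
    (quadForm (U * Matrix.diagonal (fun i => (a i : ℂ)) * Uᴴ) r).re =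
      ∑ i, a i * ‖(Uᴴ *ᵥ r) i‖ ^ 2 := by
  have : quadForm (U * Matrix.diagonal (fun i => (a i : ℂ)) * Uᴴ) r =
      star (Uᴴ *ᵥ r) ⬝ᵥ (Matrix.diagonal (fun i => (a i : ℂ)) *ᵥ (Uᴴ *ᵥ r)) := by
    rw [quadForm, Matrix.star_mulVec, Matrix.conjTranspose_conjTranspose,
      ← Matrix.dotProduct_mulVec, Matrix.mulVec_mulVec, Matrix.mulVec_mulVec]
  rw [this, dotProduct, Complex.re_sum]
  refine Finset.sum_congr rfl fun i _ => ?_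
  rw [Matrix.mulVec_diagonal, Pi.star_apply, mul_left_comm, Complex.star_def,
    ← Complex.normSq_eq_conj_mul_self, ← Complex.ofReal_mul, Complex.ofReal_re,
    Complex.normSq_eq_norm_sq]

/-- A vector whose last coordinates in a unitary basis are small is close to the span of the first
basis vectors. -/
lemma exists_close_of_coords_small {n k : ℕ} (hn : 0 < n) {U : Matrix (Fin n) (Fin n) ℂ}
    (hU : U ∈ Matrix.unitaryGroup (Fin n) ℂ) (r : Fin n → ℂ) {δ : ℝ}
    (hr : ∀ i : Fin n, k ≤ i → ‖(Uᴴ *ᵥ r) i‖ < δ / n) (hδ : 0 < δ) :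
    ∃ v ∈ Submodule.span ℂ ((fun i : Fin n => U.col i) '' {i | (i : ℕ) < k}), ‖r - v‖ < δ := by
  have hUU : U * Uᴴ = 1 := Matrix.mem_unitaryGroup_iff.1 hU
  have hexp : r = ∑ i, (Uᴴ *ᵥ r) i • U.col i := by
    conv_lhs => rw [← Matrix.one_mulVec r, ← hUU, ← Matrix.mulVec_mulVec]
    ext j
    simp [Matrix.mulVec, dotProduct, mul_comm]
  refine ⟨∑ i with (i : Fin n).val < k, (Uᴴ *ᵥ r) i • U.col i,
    Submodule.sum_mem _ fun i hi => Submodule.smul_mem _ _ (Submodule.subset_span ⟨i, ?_, rfl⟩), ?_⟩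
  · simpa using hi
  · have hsub : r - ∑ i with (i : Fin n).val < k, (Uᴴ *ᵥ r) i • U.col i =
        ∑ i with ¬ (i : Fin n).val < k, (Uᴴ *ᵥ r) i • U.col i := by
      rw [sub_eq_iff_eq_add', Finset.sum_filter_add_sum_filter_not]
      exact hexp
    rw [hsub, Finset.sum_filter]
    have hn' : (0 : ℝ) < n := by exact_mod_cast hn
    have hterm : ∀ i : Fin n,
        ‖if ¬ (i : Fin n).val < k then (Uᴴ *ᵥ r) i • U.col i else 0‖ < δ / n := by
      intro i
      by_cases h : (i : ℕ) < k
      · simpa [h] using div_pos hδ hn'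
      · rw [if_pos h, norm_smul]
        have hcol : ‖U.col i‖ ≤ 1 := (pi_norm_le_iff_of_nonneg zero_le_one).2 fun j =>
          entry_norm_bound_of_unitary hU j i
        refine lt_of_le_of_lt (mul_le_of_le_one_right (norm_nonneg _) hcol) (hr i (by omega))
    refine lt_of_le_of_lt (norm_sum_le _ _) ?_
    have : Nonempty (Fin n) := ⟨⟨0, hn⟩⟩
    calc _ < ∑ _i : Fin n, δ / n :=
          Finset.sum_lt_sum_of_nonempty Finset.univ_nonempty fun i _ => hterm i
      _ = δ := by simp; field_simp

/-- Subtracting a lower bound of the eigenvalues leaves a positive semidefinite matrix. -/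
lemma posSemidef_sub_smul_one {n : ℕ} {U : Matrix (Fin n) (Fin n) ℂ}
    (hU : U ∈ Matrix.unitaryGroup (Fin n) ℂ) (a : Fin n → ℝ) {g : ℝ} (hg : ∀ i, g ≤ a i) :
    (U * Matrix.diagonal (fun i => (a i : ℂ)) * Uᴴ -
      (g : ℂ) • (1 : Matrix (Fin n) (Fin n) ℂ)).PosSemidef := by
  have hUU : U * Uᴴ = 1 := Matrix.mem_unitaryGroup_iff.1 hU
  have : U * Matrix.diagonal (fun i => (a i : ℂ)) * Uᴴ - (g : ℂ) • 1 =
      U * Matrix.diagonal (fun i => ((a i - g : ℝ) : ℂ)) * Uᴴ := by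
    have hd : Matrix.diagonal (fun i => ((a i - g : ℝ) : ℂ)) =
        Matrix.diagonal (fun i => (a i : ℂ)) - (g : ℂ) • 1 := by
      rw [← Matrix.diagonal_one, ← Matrix.diagonal_smul, Matrix.diagonal_sub]
      congr 1
      ext i
      simp
    rw [hd, Matrix.mul_sub, Matrix.sub_mul, Matrix.mul_smul, Matrix.mul_one, Matrix.smul_mul, hUU]
  rw [this]
  refine Matrix.PosSemidef.mul_mul_conjTranspose_same
    (Matrix.posSemidef_diagonal_iff.2 fun i => ?_) U
  exact_mod_cast sub_nonneg.2 (hg i)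

/-- A positive diagonal is forced by positive definiteness of its unitary conjugate. -/
lemma diagonal_pos_of_posDef {n : ℕ} {U : Matrix (Fin n) (Fin n) ℂ}
    (hU : U ∈ Matrix.unitaryGroup (Fin n) ℂ) {a : Fin n → ℝ}
    (hA : (U * Matrix.diagonal (fun i => (a i : ℂ)) * Uᴴ).PosDef) (i : Fin n) : 0 < a i := by
  have h := (Matrix.IsUnit.posDef_star_right_conjugate_iff
    (IsUnit.of_mul_eq_one _ (Matrix.mem_unitaryGroup_iff.1 hU))).1 hA
  rw [Matrix.posDef_diagonal_iff] at h
  exact_mod_cast h i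

open Classical in
/-- Coercivity of the one-factor functional on positive definite matrices of trace `n`. The number
`a` is the least eigenvalue of `A`. -/
lemma factor_coercive {n : ℕ} (hn : 0 < n) {T : Type*} [Fintype T] (r : T → Fin n → ℂ)
    (hr : ∀ t, r t ≠ 0) {M w b κ : ℝ} (hM : 0 ≤ M) (hw : 0 ≤ w) (hκ : 0 ≤ κ)
    (hS : ∀ S : Submodule ℂ (Fin n → ℂ), S ≠ ⊥ → S ≠ ⊤ →
      w * (∑ t, if r t ∈ S then (1 : ℝ) else 0) + b < M * Module.finrank ℂ S)
    (htot : w * Fintype.card T + b = M * n - κ) :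
    ∃ ε > 0, ∃ C : ℝ, ∀ A : Matrix (Fin n) (Fin n) ℂ, A.PosDef → A.trace = n →
      ∃ a : ℝ, 0 < a ∧ a ≤ 1 ∧ (A - (a : ℂ) • (1 : Matrix (Fin n) (Fin n) ℂ)).PosSemidef ∧
        -ε * Real.log a - C ≤
          -M * Real.log A.det.re + w * ∑ t, Real.log (quadForm A (r t)).re + b * Real.log a := by
  obtain ⟨m, rfl⟩ : ∃ m, n = m + 1 := ⟨n - 1, by omega⟩
  obtain ⟨ε, hε, hmargin⟩ := exists_uniform_margin r hr hM hw hS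
  obtain ⟨δ, hδ, hclose⟩ := exists_close_finrank_span_le r
  -- Fewer than `δ / n` in each of at most `n` coordinates adds up to a distance below `δ`.
  set η : ℝ := δ / ((m + 1 : ℕ) : ℝ) with hη
  have hη0 : 0 < η := by positivity
  -- The first part of the constant comes from the largest eigenvalue being at most the trace `m +
  -- 1`; the second is the loss of a factor `η ^ 2` in each form.
  refine ⟨ε, hε, κ * Real.log (m + 1) - w * ∑ _t : T, 2 * Real.log η, fun A hA htr => ?_⟩
  obtain ⟨U, hU, a, ha, rfl⟩ := exists_unitary_diagonal_monotone hA.isHermitian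
  have hUU' : Uᴴ * U = 1 := Matrix.mem_unitaryGroup_iff'.1 hU
  have hapos := diagonal_pos_of_posDef hU hA
  have hsum : ∑ i, a i = m + 1 := by
    rw [Matrix.trace_mul_comm, ← Matrix.mul_assoc, hUU', Matrix.one_mul, Matrix.trace_diagonal]
      at htr
    exact_mod_cast htr
  have hdet : (U * Matrix.diagonal (fun i => (a i : ℂ)) * Uᴴ).det.re = ∏ i, a i := by
    rw [Matrix.det_mul_comm, ← Matrix.mul_assoc, hUU', Matrix.one_mul, Matrix.det_diagonal,
      ← Complex.ofReal_prod, Complex.ofReal_re]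
  have ha0 : a 0 ≤ 1 := by
    have : ∑ _i : Fin (m + 1), a 0 ≤ ∑ i, a i := Finset.sum_le_sum fun i _ => ha (Fin.zero_le i)
    rw [hsum] at this
    simp at this
    have hm : (0 : ℝ) < m + 1 := by positivity
    nlinarith
  have hlast1 : 1 ≤ a (Fin.last m) := by
    have : ∑ i, a i ≤ ∑ _i : Fin (m + 1), a (Fin.last m) :=
      Finset.sum_le_sum fun i _ => ha (Fin.le_last i)
    rw [hsum] at this
    simp at this
    have hm : (0 : ℝ) < m + 1 := by positivity
    nlinarith
  have hlast2 : a (Fin.last m) ≤ m + 1 := by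
    rw [← hsum]
    exact Finset.single_le_sum (fun i _ => (hapos i).le) (Finset.mem_univ _)
  refine ⟨a 0, hapos 0, ha0, ?_, ?_⟩
  · exact posSemidef_sub_smul_one hU a fun i => ha (Fin.zero_le i)
  -- The `min` only makes the index total; just the values with `k ≤ m` matter.
  · let x : ℕ → ℝ := fun k => Real.log (a ⟨min k m, by omega⟩)
    let far : T → ℕ → Prop := fun t k => ∃ i : Fin (m + 1), k ≤ i ∧ η ≤ ‖(Uᴴ *ᵥ r t) i‖
    have hnear : ∀ k (W : Set T), (∀ t ∈ W, ¬ far t k) →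
        Module.finrank ℂ (Submodule.span ℂ (r '' W)) ≤ k := by
      intro k W hW
      refine (hclose W _ fun t ht =>
        exists_close_of_coords_small hn hU (r t) (k := k) (fun i hi => ?_) hδ).trans ?_
      · by_contra hcon
        exact hW t ht ⟨i, hi, not_lt.1 hcon⟩
      · refine (finrank_span_le_card _).trans ?_
        rw [← Set.ncard_eq_toFinset_card']
        refine (Set.ncard_image_le (Set.toFinite _)).trans ?_
        rw [Set.ncard_eq_toFinset_card']
        refine (Finset.card_le_card_of_injOn (t := Finset.range k) (fun i : Fin (m + 1) => (i : ℕ))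
          (fun i hi => ?_) (fun i _ j _ h => Fin.ext h)).trans (by simp)
        simpa using hi
    have hfar : ∀ t, far t 0 := by
      intro t
      by_contra hcon
      have h0 := hnear 0 {t} (by simpa using hcon)
      rw [Set.image_singleton, finrank_span_singleton (hr t)] at h0
      omega
    have hmain := gap_sum_bound far x
      (fun t => Real.log (quadForm (U * Matrix.diagonal (fun i => (a i : ℂ)) * Uᴴ) (r t)).re
        - 2 * Real.log η) (M := M) (w := w) (b := b) (κ := κ) (ε := ε) hw m
      (fun k hk => ?_) hfar (fun t k hk hf => ?_) (fun k hk hkm => ?_)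
      (by push_cast at htot; exact htot)
    · have hx0 : x 0 = Real.log (a 0) := by simp [x]
      have hxm : x m = Real.log (a (Fin.last m)) := by
        simp only [x, min_self]
        rfl
      have hxs : ∑ i ∈ Finset.range (m + 1), x i = Real.log (∏ i, a i) := by
        rw [Real.log_prod fun i _ => (hapos i).ne', Finset.sum_range]
        refine Finset.sum_congr rfl fun i _ => ?_
        have : min (i : ℕ) m = i := by omega
        simp only [x, this]
      rw [hx0, hxm, hxs, Finset.sum_sub_distrib] at hmain
      rw [hdet]
      have h1 : 0 ≤ Real.log (a (Fin.last m)) := Real.log_nonneg hlast1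
      have h2 : Real.log (a (Fin.last m)) ≤ Real.log (m + 1) :=
        Real.log_le_log (hapos _) hlast2
      have h3 := mul_le_mul_of_nonneg_left h2 hκ
      have h4 := mul_nonneg hε.le h1
      linarith
    · exact Real.log_le_log (hapos _) (ha (by simp only [Fin.mk_le_mk]; omega))
    · obtain ⟨i, hi, hz⟩ := hf
      have hlow : a ⟨min k m, by omega⟩ * η ^ 2 ≤
          (quadForm (U * Matrix.diagonal (fun i => (a i : ℂ)) * Uᴴ) (r t)).re := by
        rw [quadForm_unitary_diagonal]
        refine le_trans ?_ (Finset.single_le_sum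
          (f := fun i => a i * ‖(Uᴴ *ᵥ r t) i‖ ^ 2)
          (fun j _ => mul_nonneg (hapos j).le (by positivity)) (Finset.mem_univ i))
        refine mul_le_mul (ha ?_) (by gcongr) (by positivity) (hapos i).le
        rw [Fin.le_def]
        simp only
        omega
      have hp := hapos ⟨min k m, by omega⟩
      have hlog := Real.log_le_log (by positivity) hlow
      rw [Real.log_mul hp.ne' (by positivity), Real.log_pow] at hlog
      push_cast at hlog
      simp only [x]
      linarith
    · have h := hmargin k hk (by omega) (Finset.univ.filter fun t => ¬ far t k)
        (hnear k _ (by simp))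
      convert h using 3
      rw [Finset.card_filter]
      push_cast
      congr 1
      refine Finset.sum_congr rfl fun t _ => ?_
      split_ifs <;> simp_all

/-! ### Hermitian perturbations and the derivative of the determinant -/

/-- A Hermitian matrix dominates some multiple of the identity. -/
lemma exists_posSemidef_sub_smul_one {n : ℕ} {H : Matrix (Fin n) (Fin n) ℂ}
    (hH : H.IsHermitian) :
    ∃ g : ℝ, (H - (g : ℂ) • (1 : Matrix (Fin n) (Fin n) ℂ)).PosSemidef := by
  obtain ⟨U, hU, a, -, rfl⟩ := exists_unitary_diagonal_monotone hH
  obtain ⟨g, hg⟩ := (Set.finite_range a).bddBelow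
  exact ⟨g, posSemidef_sub_smul_one hU a fun i => hg ⟨i, rfl⟩⟩

/-- A positive definite matrix dominates a positive multiple of the identity. -/
lemma exists_pos_posSemidef_sub_smul_one {n : ℕ} {A : Matrix (Fin n) (Fin n) ℂ}
    (hA : A.PosDef) :
    ∃ g : ℝ, 0 < g ∧ (A - (g : ℂ) • (1 : Matrix (Fin n) (Fin n) ℂ)).PosSemidef := by
  obtain ⟨U, hU, a, -, rfl⟩ := exists_unitary_diagonal_monotone hA.isHermitian
  obtain ⟨g, hg, h⟩ := exists_pos_le_of_finite (fun _ => True) a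
    fun i _ => diagonal_pos_of_posDef hU hA i
  exact ⟨g, hg, posSemidef_sub_smul_one hU a fun i => h i trivial⟩

lemma posDef_of_posSemidef_sub_smul_one {n : ℕ} {A : Matrix (Fin n) (Fin n) ℂ} {g : ℝ}
    (hg : 0 < g) (hA : (A - (g : ℂ) • (1 : Matrix (Fin n) (Fin n) ℂ)).PosSemidef) :
    A.PosDef := by
  have h1 : ((g : ℂ) • (1 : Matrix (Fin n) (Fin n) ℂ)).PosDef :=
    Matrix.PosDef.one.smul (by exact_mod_cast hg)
  simpa using h1.posSemidef_add hA

/-- Positive definiteness is stable under small Hermitian perturbations along a line. -/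
lemma eventually_posDef_add_smul {n : ℕ} {A H : Matrix (Fin n) (Fin n) ℂ} (hA : A.PosDef)
    (hH : H.IsHermitian) : ∀ᶠ t : ℝ in nhds 0, (A + (t : ℂ) • H).PosDef := by
  obtain ⟨a, ha, hAa⟩ := exists_pos_posSemidef_sub_smul_one hA
  obtain ⟨g₁, hg₁⟩ := exists_posSemidef_sub_smul_one hH
  -- A lower bound for `-H` handles negative `t`.
  obtain ⟨g₂, hg₂⟩ := exists_posSemidef_sub_smul_one hH.neg
  have h1 : ∀ᶠ t : ℝ in nhds 0, 0 < a + t * g₁ :=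
    (Continuous.tendsto' (by fun_prop) 0 a (by simp)).eventually (lt_mem_nhds ha)
  have h2 : ∀ᶠ t : ℝ in nhds 0, 0 < a + -t * g₂ :=
    (Continuous.tendsto' (by fun_prop) 0 a (by simp)).eventually (lt_mem_nhds ha)
  filter_upwards [h1, h2] with t ht1 ht2
  rcases le_total 0 t with h | h
  · refine posDef_of_posSemidef_sub_smul_one ht1 ?_
    have := hAa.add (hg₁.smul (a := (t : ℂ)) (by exact_mod_cast h))
    convert this using 1
    push_cast
    module
  · refine posDef_of_posSemidef_sub_smul_one ht2 ?_
    have := hAa.add (hg₂.smul (a := ((-t : ℝ) : ℂ)) (by exact_mod_cast neg_nonneg.2 h))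
    convert this using 1
    push_cast
    module

/-- Jacobi's formula: after factoring out `A`, the polynomial det(1 + zX) is 1 + z tr X plus a
multiple of z². -/
lemma hasDerivAt_det_add_smul {n : ℕ} {A : Matrix (Fin n) (Fin n) ℂ} (hA : IsUnit A.det)
    (H : Matrix (Fin n) (Fin n) ℂ) :
    HasDerivAt (fun z : ℂ => (A + z • H).det) (A.det * (A⁻¹ * H).trace) 0 := by
  set p := (Matrix.det (1 + (Polynomial.X : Polynomial ℂ) •
    (A⁻¹ * H).map Polynomial.C)).divX.divX with hp
  have hfac : ∀ z : ℂ, (A + z • H).det =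
      A.det * (1 + (A⁻¹ * H).trace * z + p.eval z * z ^ 2) := by
    intro z
    rw [hp, ← Matrix.det_one_add_smul, ← Matrix.det_mul, Matrix.mul_add, Matrix.mul_one, Matrix.mul_smul,
      Matrix.mul_nonsing_inv_cancel_left _ _ hA]
  simp_rw [hfac]
  have h1 : HasDerivAt (fun z : ℂ => p.eval z * z ^ 2) 0 0 := by
    have := (p.hasDerivAt 0).mul (hasDerivAt_pow 2 (0 : ℂ))
    simpa using! this
  have h2 : HasDerivAt (fun z : ℂ => 1 + (A⁻¹ * H).trace * z) (A⁻¹ * H).trace 0 := by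
    simpa using ((hasDerivAt_id (0 : ℂ)).const_mul (A⁻¹ * H).trace).const_add 1
  simpa using (h2.add h1).const_mul A.det

/-! ### The one-factor functional: stationarity and scaling -/

noncomputable section

/-- The part of the penalized likelihood that depends on one precision factor `A`, the other one
entering through the matrices `K l`. -/
def factorCost {n : ℕ} {ι : Type*} [Fintype ι] (M c α : ℝ) (K : ι → Matrix (Fin n) (Fin n) ℂ)
    (A : Matrix (Fin n) (Fin n) ℂ) : ℝ :=
  -M * Real.log A.det.re + c * ∑ l, Real.log (A * K l).trace.re + α * A.trace.re

end

lemma ofReal_re_of_pos {z : ℂ} (hz : 0 < z) : ((z.re : ℝ) : ℂ) = z :=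
  Complex.ext rfl (by simpa using (Complex.pos_iff.1 hz).2)

/-- Stationarity of the one-factor functional at a minimizer. -/
lemma factorCost_stationary {n : ℕ} {ι : Type*} [Fintype ι] {M c α : ℝ}
    {K : ι → Matrix (Fin n) (Fin n) ℂ} {A : Matrix (Fin n) (Fin n) ℂ} (hA : A.PosDef)
    (hK : ∀ l, (K l).IsHermitian) (hAK : ∀ l, 0 < (A * K l).trace)
    (hmin : ∀ A' : Matrix (Fin n) (Fin n) ℂ, A'.PosDef →
      factorCost M c α K A ≤ factorCost M c α K A') :
    (M : ℂ) • A⁻¹ = (c : ℂ) • ∑ l, (A * K l).trace⁻¹ • K l + (α : ℂ) • 1 := by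
  -- `G` is the gradient at `A`, and it is also taken as the direction of variation: the derivative
  -- along it is tr(GᴴG), which vanishes only for `G = 0`.
  set G : Matrix (Fin n) (Fin n) ℂ :=
    (α : ℂ) • 1 + (c : ℂ) • ∑ l, (A * K l).trace⁻¹ • K l - (M : ℂ) • A⁻¹ with hG
  have hsmul : ∀ (s : ℝ) {X : Matrix (Fin n) (Fin n) ℂ}, X.IsHermitian →
      ((s : ℂ) • X).IsHermitian := by
    intro s X hX
    rw [Matrix.IsHermitian, Matrix.conjTranspose_smul, hX.eq]
    simp
  have hinv : ∀ l, (A * K l).trace⁻¹ = (((A * K l).trace.re⁻¹ : ℝ) : ℂ) := fun l => by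
    rw [Complex.ofReal_inv, ofReal_re_of_pos (hAK l)]
  have hGH : G.IsHermitian := by
    refine ((hsmul α Matrix.isHermitian_one).add (hsmul c ?_)).sub
      (hsmul M hA.isHermitian.inv)
    rw [Matrix.IsHermitian, Matrix.conjTranspose_sum]
    refine Finset.sum_congr rfl fun l _ => ?_
    rw [hinv]
    exact (hsmul _ (hK l)).eq
  have hdetpos := hA.det_pos
  have hdet0 : 0 < A.det.re := (Complex.pos_iff.1 hdetpos).1
  have hK0 : ∀ l, 0 < (A * K l).trace.re := fun l => (Complex.pos_iff.1 (hAK l)).1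
  have htrderiv : ∀ X : Matrix (Fin n) (Fin n) ℂ,
      HasDerivAt (fun t : ℝ => ((A + (t : ℂ) • G) * X).trace.re) (G * X).trace.re 0 := by
    intro X
    have h : ∀ t : ℝ, ((A + (t : ℂ) • G) * X).trace.re =
        (A * X).trace.re + t * (G * X).trace.re := by
      intro t
      simp [Matrix.add_mul, Matrix.trace_add, Matrix.trace_smul]
    simp_rw [h]
    simpa using ((hasDerivAt_id (0 : ℝ)).mul_const (G * X).trace.re).const_add (A * X).trace.re
  have hdetderiv : HasDerivAt (fun t : ℝ => (A + (t : ℂ) • G).det.re)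
      (A.det * (A⁻¹ * G).trace).re 0 := by
    have h := hasDerivAt_det_add_smul (A := A) (isUnit_iff_ne_zero.2 hdetpos.ne') G
    rw [← Complex.ofReal_zero] at h
    exact h.real_of_complex
  have hderiv : HasDerivAt (fun t : ℝ => factorCost M c α K (A + (t : ℂ) • G))
      (-M * ((A.det * (A⁻¹ * G).trace).re / A.det.re) +
        c * ∑ l, (G * K l).trace.re / (A * K l).trace.re + α * G.trace.re) 0 := by
    have d1 := (hdetderiv.log (by simpa using hdet0.ne')).const_mul (-M)
    have d2 := (HasDerivAt.fun_sum (u := Finset.univ) fun l _ =>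
      (htrderiv (K l)).log (by simpa using (hK0 l).ne')).const_mul c
    have d3 := (htrderiv 1).const_mul α
    simp only [Matrix.mul_one] at d3
    have := (d1.add d2).add d3
    simpa [factorCost] using! this
  have hlocal : IsLocalMin (fun t : ℝ => factorCost M c α K (A + (t : ℂ) • G)) 0 := by
    filter_upwards [eventually_posDef_add_smul hA hGH] with t ht
    simpa using hmin _ ht
  have hzero := hlocal.hasDerivAt_eq_zero hderiv
  have hdetre : (A.det * (A⁻¹ * G).trace).re / A.det.re = (A⁻¹ * G).trace.re := by
    rw [← ofReal_re_of_pos hdetpos, Complex.re_ofReal_mul, Complex.ofReal_re]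
    field_simp
  rw [hdetre] at hzero
  have htrace : (Gᴴ * G).trace.re = 0 := by
    have hGG : G * G = ((α : ℂ) • 1 + (c : ℂ) • ∑ l, (A * K l).trace⁻¹ • K l
        - (M : ℂ) • A⁻¹) * G := congrArg (· * G) hG
    rw [hGH.eq, ← hzero, hGG]
    simp only [Matrix.sub_mul, Matrix.add_mul, Matrix.smul_mul, Matrix.one_mul, Matrix.sum_mul,
      Matrix.trace_sub, Matrix.trace_add, Matrix.trace_smul, Matrix.trace_sum, hinv,
      smul_eq_mul, Complex.sub_re, Complex.add_re, Complex.re_ofReal_mul, Complex.re_sum]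
    have : ∀ l, (A * K l).trace.re⁻¹ * (K l * G).trace.re =
        (G * K l).trace.re / (A * K l).trace.re := fun l => by
      rw [Matrix.trace_mul_comm (K l) G, div_eq_inv_mul]
    simp_rw [this]
    ring
  have hnn := (Complex.nonneg_iff.1 (Matrix.posSemidef_conjTranspose_mul_self G).trace_nonneg).2
  have hG0 : G = 0 := Matrix.trace_conjTranspose_mul_self_eq_zero_iff.1
    (Complex.ext htrace (by simpa using hnn.symm))
  rw [hG, sub_eq_zero] at hG0
  rw [← hG0, add_comm]

/-- Rescaling a positive definite matrix to trace `n` does not increase the one-factor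
functional. -/
lemma exists_rescale_factorCost_le {n : ℕ} (hn : 0 < n) {ι : Type*} [Fintype ι] {M c α : ℝ}
    (hα : 0 ≤ α) (hM : M * n = c * Fintype.card ι + α * n) {K : ι → Matrix (Fin n) (Fin n) ℂ}
    {A : Matrix (Fin n) (Fin n) ℂ} (hA : A.PosDef) (hAK : ∀ l, 0 < (A * K l).trace) :
    ∃ A' : Matrix (Fin n) (Fin n) ℂ, A'.PosDef ∧ A'.trace = n ∧
      factorCost M c α K A' ≤ factorCost M c α K A := by
  have : Nonempty (Fin n) := ⟨⟨0, hn⟩⟩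
  have hn' : (0 : ℝ) < n := by exact_mod_cast hn
  have htr := hA.trace_pos
  have hτ : 0 < A.trace.re := (Complex.pos_iff.1 htr).1
  have hs : 0 < n / A.trace.re := by positivity
  set s : ℝ := n / A.trace.re with hsdef
  have hdet0 : 0 < A.det.re := (Complex.pos_iff.1 hA.det_pos).1
  have hK0 : ∀ l, 0 < (A * K l).trace.re := fun l => (Complex.pos_iff.1 (hAK l)).1
  refine ⟨(s : ℂ) • A, hA.smul (by exact_mod_cast hs), ?_, ?_⟩
  · rw [Matrix.trace_smul, ← ofReal_re_of_pos htr, smul_eq_mul, ← Complex.ofReal_mul, hsdef,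
      div_mul_cancel₀ _ hτ.ne', Complex.ofReal_natCast]
  · have h1 : Real.log ((s : ℂ) • A).det.re = n * Real.log s + Real.log A.det.re := by
      rw [Matrix.det_smul, Fintype.card_fin, ← Complex.ofReal_pow, Complex.re_ofReal_mul,
        Real.log_mul (by positivity) hdet0.ne', Real.log_pow]
    have h2 : ∑ l, Real.log ((s : ℂ) • A * K l).trace.re =
        Fintype.card ι * Real.log s + ∑ l, Real.log (A * K l).trace.re := by
      have : ∀ l, Real.log ((s : ℂ) • A * K l).trace.re =
          Real.log s + Real.log (A * K l).trace.re := fun l => by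
        rw [Matrix.smul_mul, Matrix.trace_smul, smul_eq_mul, Complex.re_ofReal_mul,
          Real.log_mul hs.ne' (hK0 l).ne']
      simp_rw [this, Finset.sum_add_distrib]
      simp
    have h3 : ((s : ℂ) • A).trace.re = n := by
      rw [Matrix.trace_smul, smul_eq_mul, Complex.re_ofReal_mul, hsdef,
        div_mul_cancel₀ _ hτ.ne']
    -- By `hM` the logarithms cancel up to a net change of α(n(1 - log s) - tr A). It is nonpositive
    -- because log s⁻¹ ≤ s⁻¹ - 1 and n s⁻¹ = tr A.
    have h4 : n * (1 + -Real.log s) ≤ A.trace.re := by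
      have hlog := Real.log_le_sub_one_of_pos (inv_pos.2 hs)
      rw [Real.log_inv] at hlog
      have : n * s⁻¹ = A.trace.re := by rw [hsdef]; field_simp
      nlinarith
    have h5 := mul_le_mul_of_nonneg_left h4 hα
    have h6 : M * (n * Real.log s) = (c * Fintype.card ι + α * n) * Real.log s := by
      rw [← hM]; ring
    rw [factorCost, factorCost, h1, h2, h3]
    linarith

/-! ### Kronecker forms in terms of rows and columns -/

variable {Nst Np : ℕ}

/-- For fixed `B` the form is linear in `A`, which turns the data term into that of `factorCost`.
The transpose appears because rows are not conjugated. -/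
lemma quadForm_kronecker_eq_trace_left (A : Matrix (Fin Nst) (Fin Nst) ℂ)
    (B : Matrix (Fin Np) (Fin Np) ℂ) (y : Fin Nst × Fin Np → ℂ) :
    quadForm (A ⊗ₖ B) y = (A * ((unvec y)ᴴ * B * unvec y)ᵀ).trace := by
  simp only [quadForm, dotProduct, Matrix.mulVec, Matrix.trace, Matrix.diag, Matrix.mul_apply,
    Fintype.sum_prod_type, Matrix.kroneckerMap_apply, Matrix.transpose_apply, unvec,
    Matrix.conjTranspose_apply, Matrix.of_apply, Pi.star_apply, Finset.mul_sum, Finset.sum_mul]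
  refine Finset.sum_congr rfl fun i _ => ?_
  rw [Finset.sum_comm]
  refine Finset.sum_congr rfl fun i' _ => ?_
  rw [Finset.sum_comm]
  refine Finset.sum_congr rfl fun j' _ => Finset.sum_congr rfl fun j _ => ?_
  ring

lemma quadForm_kronecker_eq_trace_right (A : Matrix (Fin Nst) (Fin Nst) ℂ)
    (B : Matrix (Fin Np) (Fin Np) ℂ) (y : Fin Nst × Fin Np → ℂ) :
    quadForm (A ⊗ₖ B) y = (B * (unvec y * Aᵀ * (unvec y)ᴴ)).trace := by
  rw [quadForm_kronecker_eq_trace_left, ← Matrix.trace_transpose, Matrix.transpose_mul,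
    Matrix.transpose_transpose, Matrix.mul_assoc, Matrix.mul_assoc, Matrix.trace_mul_comm,
    Matrix.mul_assoc]

lemma quadForm_kronecker_one_right (A : Matrix (Fin Nst) (Fin Nst) ℂ)
    (y : Fin Nst × Fin Np → ℂ) :
    quadForm (A ⊗ₖ (1 : Matrix (Fin Np) (Fin Np) ℂ)) y =
      ∑ j, quadForm A ((unvec y).row j) := by
  simp only [quadForm, dotProduct, Matrix.mulVec, Fintype.sum_prod_type,
    Matrix.kroneckerMap_apply, Matrix.one_apply, unvec, Matrix.row, Matrix.of_apply,
    Pi.star_apply]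
  rw [Finset.sum_comm]
  simp

lemma quadForm_kronecker_one_left (B : Matrix (Fin Np) (Fin Np) ℂ)
    (y : Fin Nst × Fin Np → ℂ) :
    quadForm ((1 : Matrix (Fin Nst) (Fin Nst) ℂ) ⊗ₖ B) y =
      ∑ i, quadForm B ((unvec y).col i) := by
  simp only [quadForm, dotProduct, Matrix.mulVec, Fintype.sum_prod_type,
    Matrix.kroneckerMap_apply, Matrix.one_apply, unvec, Matrix.col,
    Pi.star_apply]
  simp [Matrix.transpose]

lemma quadForm_add {ι : Type*} [Fintype ι] (M M' : Matrix ι ι ℂ) (y : ι → ℂ) :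
    quadForm (M + M') y = quadForm M y + quadForm M' y := by
  simp [quadForm, Matrix.add_mulVec]

lemma quadForm_smul {ι : Type*} [Fintype ι] (s : ℂ) (M : Matrix ι ι ℂ) (y : ι → ℂ) :
    quadForm (s • M) y = s * quadForm M y := by
  simp [quadForm, Matrix.smul_mulVec]

lemma quadForm_re_nonneg {ι : Type*} [Fintype ι] {M : Matrix ι ι ℂ} (hM : M.PosSemidef)
    (y : ι → ℂ) : 0 ≤ (quadForm M y).re :=
  (Complex.nonneg_iff.1 (hM.dotProduct_mulVec_nonneg y)).1

lemma quadForm_pos {ι : Type*} [Fintype ι] {M : Matrix ι ι ℂ} (hM : M.PosDef)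
    {y : ι → ℂ} (hy : y ≠ 0) : 0 < quadForm M y :=
  hM.dotProduct_mulVec_pos hy

lemma quadForm_re_pos {ι : Type*} [Fintype ι] {M : Matrix ι ι ℂ} (hM : M.PosDef)
    {y : ι → ℂ} (hy : y ≠ 0) : 0 < (quadForm M y).re :=
  (Complex.pos_iff.1 (quadForm_pos hM hy)).1

/-- If `m` positive numbers `q j` satisfy `b * ∑ q ≤ Q`, then `log Q - log b` dominates the mean of
their logarithms. -/
lemma log_add_mean_log_le {m : ℕ} (hm : 0 < m) {q : Fin m → ℝ} (hq : ∀ j, 0 < q j) {b Q : ℝ}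
    (hb : 0 < b) (hQ : b * ∑ j, q j ≤ Q) :
    Real.log b + (∑ j, Real.log (q j)) / m ≤ Real.log Q := by
  have hm' : (0 : ℝ) < m := by exact_mod_cast hm
  have h : ∀ j, Real.log (q j) ≤ Real.log Q - Real.log b := fun j => by
    have h1 : b * q j ≤ Q := le_trans (mul_le_mul_of_nonneg_left
      (Finset.single_le_sum (fun i _ => (hq i).le) (Finset.mem_univ j)) hb.le) hQ
    have h2 := Real.log_le_log (mul_pos hb (hq j)) h1
    rw [Real.log_mul hb.ne' (hq j).ne'] at h2
    linarith
  have h3 : ∑ j, Real.log (q j) ≤ m * (Real.log Q - Real.log b) := by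
    refine (Finset.sum_le_sum fun j _ => h j).trans (le_of_eq ?_)
    rw [Finset.sum_const, Finset.card_univ, Fintype.card_fin, nsmul_eq_mul]
  have h4 : (∑ j, Real.log (q j)) / m ≤ Real.log Q - Real.log b := by
    rw [div_le_iff₀ hm']
    linarith
  linarith

/-- Since `A ⊗ₖ (B - b • 1)` is positive semidefinite, `B` may be replaced by `b • 1`, and the form
then splits into a sum over rows. This decouples `A` from `B` at the price of `log b`. -/
lemma log_quadForm_kronecker_ge_rows (hNp : 0 < Np) {A : Matrix (Fin Nst) (Fin Nst) ℂ}
    {B : Matrix (Fin Np) (Fin Np) ℂ} (hA : A.PosDef) {b : ℝ} (hb : 0 < b)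
    (hB : (B - (b : ℂ) • (1 : Matrix (Fin Np) (Fin Np) ℂ)).PosSemidef)
    {y : Fin Nst × Fin Np → ℂ} (hrow : ∀ j, (unvec y).row j ≠ 0) :
    Real.log b + (∑ j, Real.log (quadForm A ((unvec y).row j)).re) / Np ≤
      Real.log (quadForm (A ⊗ₖ B) y).re := by
  refine log_add_mean_log_le hNp (fun j => quadForm_re_pos hA (hrow j)) hb ?_
  have hsplit : A ⊗ₖ B = A ⊗ₖ (B - (b : ℂ) • 1) + (b : ℂ) • (A ⊗ₖ 1) := by
    rw [← Matrix.kronecker_smul, ← Matrix.kronecker_add, sub_add_cancel]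
  rw [hsplit, quadForm_add, quadForm_smul, quadForm_kronecker_one_right, Complex.add_re,
    Complex.re_ofReal_mul, Complex.re_sum]
  linarith [quadForm_re_nonneg (hA.posSemidef.kronecker hB) y]

lemma log_quadForm_kronecker_ge_cols (hNst : 0 < Nst) {A : Matrix (Fin Nst) (Fin Nst) ℂ}
    {B : Matrix (Fin Np) (Fin Np) ℂ} (hB : B.PosDef) {a : ℝ} (ha : 0 < a)
    (hA : (A - (a : ℂ) • (1 : Matrix (Fin Nst) (Fin Nst) ℂ)).PosSemidef)
    {y : Fin Nst × Fin Np → ℂ} (hcol : ∀ i, (unvec y).col i ≠ 0) :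
    Real.log a + (∑ i, Real.log (quadForm B ((unvec y).col i)).re) / Nst ≤
      Real.log (quadForm (A ⊗ₖ B) y).re := by
  refine log_add_mean_log_le hNst (fun i => quadForm_re_pos hB (hcol i)) ha ?_
  have hsplit : A ⊗ₖ B = (A - (a : ℂ) • 1) ⊗ₖ B + (a : ℂ) • (1 ⊗ₖ B) := by
    rw [← Matrix.smul_kronecker, ← Matrix.add_kronecker, sub_add_cancel]
  rw [hsplit, quadForm_add, quadForm_smul, quadForm_kronecker_one_left, Complex.add_re,
    Complex.re_ofReal_mul, Complex.re_sum]
  linarith [quadForm_re_nonneg (hA.kronecker hB.posSemidef) y]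

/-! ### Compactness of normalized sets -/

/-- The entries of a positive semidefinite matrix are bounded by its trace. -/
lemma norm_entry_le_of_trace_eq {n : ℕ} {A : Matrix (Fin n) (Fin n) ℂ} (hA : A.PosSemidef)
    (htr : A.trace = n) (i j : Fin n) : ‖A i j‖ ≤ n := by
  have hd : ∀ k, 0 ≤ (A k k).re ∧ (A k k).re ≤ n := by
    intro k
    have h0 : ∀ k, 0 ≤ (A k k).re := fun k => (Complex.nonneg_iff.1 (hA.diag_nonneg (i := k))).1
    refine ⟨h0 k, ?_⟩
    have h1 : ∑ k, (A k k).re = n := by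
      rw [← Complex.re_sum]
      simpa [Matrix.trace] using congrArg Complex.re htr
    rw [← h1]
    exact Finset.single_le_sum (fun k _ => h0 k) (Finset.mem_univ k)
  -- The 2×2 minor on `i`, `j` gives |A i j|² ≤ A i i · A j j; for `i = j` the repeated index is
  -- harmless.
  have hdet := (Complex.nonneg_iff.1 (hA.submatrix ![i, j]).det_nonneg).1
  have him : ∀ k, (A k k).im = 0 := fun k =>
    ((Complex.nonneg_iff.1 (hA.diag_nonneg (i := k))).2).symm
  have hji : A j i = star (A i j) := (hA.isHermitian.apply j i).symm
  rw [Matrix.det_fin_two] at hdet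
  simp only [Matrix.submatrix_apply, Matrix.cons_val_zero, Matrix.cons_val_one, hji,
    Complex.star_def, Complex.mul_conj, Complex.sub_re, Complex.ofReal_re, Complex.mul_re,
    him, Complex.normSq_eq_norm_sq] at hdet
  have h2 : (A i i).re * (A j j).re ≤ n * n :=
    mul_le_mul (hd i).2 (hd j).2 (hd j).1 (Nat.cast_nonneg n)
  refine abs_le_of_sq_le_sq' (b := (n : ℝ)) ?_ (Nat.cast_nonneg n) |>.2
  nlinarith

lemma isClosed_setOf_posSemidef (n : ℕ) :
    IsClosed {A : Matrix (Fin n) (Fin n) ℂ | A.PosSemidef} := by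
  simp only [Matrix.posSemidef_iff_dotProduct_mulVec, Set.ofPred_and, Set.ofPred_forall]
  refine IsClosed.inter (isClosed_eq (by fun_prop) continuous_id) (isClosed_iInter fun x => ?_)
  exact isClosed_le continuous_const (by fun_prop)

/-- The normalized matrices dominating `a • 1` form a compact set. -/
lemma isCompact_setOf_trace_eq {n : ℕ} {a : ℝ} (ha : 0 < a) :
    IsCompact {A : Matrix (Fin n) (Fin n) ℂ | A.trace = n ∧
      (A - (a : ℂ) • (1 : Matrix (Fin n) (Fin n) ℂ)).PosSemidef} := by
  have hbox : IsCompact (Set.pi Set.univ fun _ : Fin n => Set.pi Set.univ fun _ : Fin n =>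
      Metric.closedBall (0 : ℂ) n) :=
    isCompact_univ_pi fun _ => isCompact_univ_pi fun _ => isCompact_closedBall _ _
  refine IsCompact.of_isClosed_subset hbox ?_ fun A hA i _ j _ => ?_
  · refine IsClosed.inter (isClosed_eq (Continuous.matrix_trace continuous_id) continuous_const) ?_
    exact (isClosed_setOf_posSemidef n).preimage
      (f := fun A : Matrix (Fin n) (Fin n) ℂ => A - (a : ℂ) • 1) (by fun_prop)
  · rw [mem_closedBall_zero_iff]
    exact norm_entry_le_of_trace_eq (posDef_of_posSemidef_sub_smul_one ha hA.2).posSemidef hA.1 i j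

lemma posSemidef_sub_smul_one_mono {n : ℕ} {A : Matrix (Fin n) (Fin n) ℂ} {g g' : ℝ}
    (hg : g' ≤ g) (hA : (A - (g : ℂ) • (1 : Matrix (Fin n) (Fin n) ℂ)).PosSemidef) :
    (A - (g' : ℂ) • (1 : Matrix (Fin n) (Fin n) ℂ)).PosSemidef := by
  have := hA.add ((Matrix.PosSemidef.one (n := Fin n) (R := ℂ)).smul
    (a := ((g - g' : ℝ) : ℂ)) (by exact_mod_cast sub_nonneg.2 hg))
  convert this using 1
  push_cast
  module

end RSKE

/-! ### The joint functional: minimizer and coercivity -/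

namespace RSKE

noncomputable section

/-- The penalized negative log-likelihood as a function of the precision matrices
`A = Rst⁻¹` and `B = Rp⁻¹`. -/
def precisionCost {L Nst Np : ℕ} (M₁ M₂ c α₁ α₂ : ℝ) (y : Fin L → Fin Nst × Fin Np → ℂ)
    (A : Matrix (Fin Nst) (Fin Nst) ℂ) (B : Matrix (Fin Np) (Fin Np) ℂ) : ℝ :=
  -M₁ * Real.log A.det.re - M₂ * Real.log B.det.re
    + c * ∑ l, Real.log (quadForm (A ⊗ₖ B) (y l)).re + α₁ * A.trace.re + α₂ * B.trace.re

end

variable {L Nst Np : ℕ} {M₁ M₂ c α₁ α₂ : ℝ} {y : Fin L → Fin Nst × Fin Np → ℂ}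

lemma precisionCost_eq_left (A : Matrix (Fin Nst) (Fin Nst) ℂ) (B : Matrix (Fin Np) (Fin Np) ℂ) :
    precisionCost M₁ M₂ c α₁ α₂ y A B =
      factorCost M₁ c α₁ (fun l => ((unvec (y l))ᴴ * B * unvec (y l))ᵀ) A
        + (-M₂ * Real.log B.det.re + α₂ * B.trace.re) := by
  simp only [precisionCost, factorCost, quadForm_kronecker_eq_trace_left]
  ring

lemma precisionCost_eq_right (A : Matrix (Fin Nst) (Fin Nst) ℂ) (B : Matrix (Fin Np) (Fin Np) ℂ) :
    precisionCost M₁ M₂ c α₁ α₂ y A B =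
      factorCost M₂ c α₂ (fun l => unvec (y l) * Aᵀ * (unvec (y l))ᴴ) B
        + (-M₁ * Real.log A.det.re + α₁ * A.trace.re) := by
  simp only [precisionCost, factorCost, quadForm_kronecker_eq_trace_right]
  ring

/-- The functional `precisionCost` is continuous where it is finite. -/
lemma continuousOn_precisionCost (hy : ∀ l, y l ≠ 0) :
    ContinuousOn (fun p : Matrix (Fin Nst) (Fin Nst) ℂ × Matrix (Fin Np) (Fin Np) ℂ =>
      precisionCost M₁ M₂ c α₁ α₂ y p.1 p.2) {p | p.1.PosDef ∧ p.2.PosDef} := by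
  have hdet : ∀ {n : ℕ} {A : Matrix (Fin n) (Fin n) ℂ}, A.PosDef → A.det.re ≠ 0 :=
    fun hA => (Complex.pos_iff.1 hA.det_pos).1.ne'
  unfold precisionCost
  refine ContinuousOn.add (ContinuousOn.add (ContinuousOn.add (ContinuousOn.sub ?_ ?_) ?_) ?_) ?_
  · refine continuousOn_const.mul (ContinuousOn.log (Continuous.continuousOn ?_) fun p hp =>
      hdet hp.1)
    exact Complex.continuous_re.comp continuous_fst.matrix_det
  · refine continuousOn_const.mul (ContinuousOn.log (Continuous.continuousOn ?_) fun p hp =>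
      hdet hp.2)
    exact Complex.continuous_re.comp continuous_snd.matrix_det
  · refine continuousOn_const.mul (continuousOn_finsetSum _ fun l _ =>
      ContinuousOn.log (Continuous.continuousOn ?_) fun p hp =>
        (quadForm_re_pos (hp.1.kronecker hp.2) (hy l)).ne')
    simp only [quadForm_kronecker_eq_trace_left]
    refine Complex.continuous_re.comp (Continuous.matrix_trace ?_)
    fun_prop
  · exact (continuous_const.mul
      (Complex.continuous_re.comp continuous_fst.matrix_trace)).continuousOn
  · exact (continuous_const.mul
      (Complex.continuous_re.comp continuous_snd.matrix_trace)).continuousOn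

/-- A functional that is coercive on normalized pairs and scale-compatible attains its minimum over
all pairs of positive definite matrices. -/
lemma exists_minimizer_precisionCost (hNst : 0 < Nst) (hNp : 0 < Np) (hy : ∀ l, y l ≠ 0)
    (hα₁ : 0 ≤ α₁) (hα₂ : 0 ≤ α₂) (hM₁ : M₁ * Nst = c * L + α₁ * Nst)
    (hM₂ : M₂ * Np = c * L + α₂ * Np) {ε₁ ε₂ C : ℝ} (hε₁ : 0 < ε₁) (hε₂ : 0 < ε₂)
    (hcoer : ∀ (A : Matrix (Fin Nst) (Fin Nst) ℂ) (B : Matrix (Fin Np) (Fin Np) ℂ),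
      A.PosDef → B.PosDef → A.trace = Nst → B.trace = Np →
      ∃ a b : ℝ, 0 < a ∧ a ≤ 1 ∧ 0 < b ∧ b ≤ 1 ∧
        (A - (a : ℂ) • (1 : Matrix (Fin Nst) (Fin Nst) ℂ)).PosSemidef ∧
        (B - (b : ℂ) • (1 : Matrix (Fin Np) (Fin Np) ℂ)).PosSemidef ∧
        -ε₁ * Real.log a - ε₂ * Real.log b - C ≤ precisionCost M₁ M₂ c α₁ α₂ y A B) :
    ∃ (A : Matrix (Fin Nst) (Fin Nst) ℂ) (B : Matrix (Fin Np) (Fin Np) ℂ),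
      A.PosDef ∧ B.PosDef ∧ ∀ (A' : Matrix (Fin Nst) (Fin Nst) ℂ) (B' : Matrix (Fin Np) (Fin Np) ℂ),
        A'.PosDef → B'.PosDef →
        precisionCost M₁ M₂ c α₁ α₂ y A B ≤ precisionCost M₁ M₂ c α₁ α₂ y A' B' := by
  let J := fun p : Matrix (Fin Nst) (Fin Nst) ℂ × Matrix (Fin Np) (Fin Np) ℂ =>
    precisionCost M₁ M₂ c α₁ α₂ y p.1 p.2
  set J₁ : ℝ := J (1, 1) with hJ₁
  -- Coercivity makes -ε₁ log a ≤ J₁ + C on the sublevel set of (1, 1), that is, a ≥ `a₀`; likewise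
  -- for `b₀`. So `S` contains every normalized pair in that set.
  let a₀ : ℝ := Real.exp (-(J₁ + C) / ε₁)
  let b₀ : ℝ := Real.exp (-(J₁ + C) / ε₂)
  let S : Set (Matrix (Fin Nst) (Fin Nst) ℂ × Matrix (Fin Np) (Fin Np) ℂ) :=
    {A : Matrix (Fin Nst) (Fin Nst) ℂ | A.trace = Nst ∧
      (A - (a₀ : ℂ) • (1 : Matrix (Fin Nst) (Fin Nst) ℂ)).PosSemidef} ×ˢ
    {B : Matrix (Fin Np) (Fin Np) ℂ | B.trace = Np ∧
      (B - (b₀ : ℂ) • (1 : Matrix (Fin Np) (Fin Np) ℂ)).PosSemidef}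
  have hSpd : ∀ p ∈ S, p.1.PosDef ∧ p.2.PosDef := fun p hp =>
    ⟨posDef_of_posSemidef_sub_smul_one (Real.exp_pos _) hp.1.2,
      posDef_of_posSemidef_sub_smul_one (Real.exp_pos _) hp.2.2⟩
  have hmem : ∀ (A : Matrix (Fin Nst) (Fin Nst) ℂ) (B : Matrix (Fin Np) (Fin Np) ℂ),
      A.PosDef → B.PosDef → A.trace = Nst → B.trace = Np → J (A, B) ≤ J₁ → (A, B) ∈ S := by
    intro A B hA hB htA htB hJ
    obtain ⟨a, b, ha, ha1, hb, hb1, hAa, hBb, hle⟩ := hcoer A B hA hB htA htB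
    have hla : Real.log a ≤ 0 := Real.log_nonpos ha.le ha1
    have hlb : Real.log b ≤ 0 := Real.log_nonpos hb.le hb1
    have h := hle.trans hJ
    have h1 := mul_nonneg hε₁.le (neg_nonneg.2 hla)
    have h2 := mul_nonneg hε₂.le (neg_nonneg.2 hlb)
    refine ⟨⟨htA, posSemidef_sub_smul_one_mono ?_ hAa⟩, ⟨htB, posSemidef_sub_smul_one_mono ?_ hBb⟩⟩
    · rw [← Real.le_log_iff_exp_le ha, div_le_iff₀ hε₁]
      linarith
    · rw [← Real.le_log_iff_exp_le hb, div_le_iff₀ hε₂]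
      linarith
  have h11 : ((1, 1) : Matrix (Fin Nst) (Fin Nst) ℂ × Matrix (Fin Np) (Fin Np) ℂ) ∈ S :=
    hmem 1 1 Matrix.PosDef.one Matrix.PosDef.one (by simp) (by simp) le_rfl
  have hScompact : IsCompact S := (isCompact_setOf_trace_eq (Real.exp_pos _)).prod
    (isCompact_setOf_trace_eq (Real.exp_pos _))
  obtain ⟨p, hp, hmin⟩ := hScompact.exists_isMinOn ⟨_, h11⟩
    ((continuousOn_precisionCost (M₁ := M₁) (M₂ := M₂) (c := c) (α₁ := α₁) (α₂ := α₂) hy).mono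
      hSpd)
  have hle : ∀ q ∈ S, J p ≤ J q := isMinOn_iff.1 hmin
  refine ⟨p.1, p.2, (hSpd p hp).1, (hSpd p hp).2, fun A B hA hB => ?_⟩
  -- One factor is rescaled at a time: `A` with `B` fixed, then `B` against the new `A'`.
  obtain ⟨A', hA', htA', hle1⟩ := exists_rescale_factorCost_le hNst hα₁
    (by simpa using hM₁) (K := fun l => ((unvec (y l))ᴴ * B * unvec (y l))ᵀ) hA fun l => by
      rw [← quadForm_kronecker_eq_trace_left]
      exact quadForm_pos (hA.kronecker hB) (hy l)
  obtain ⟨B', hB', htB', hle2⟩ := exists_rescale_factorCost_le hNp hα₂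
    (by simpa using hM₂) (K := fun l => unvec (y l) * A'ᵀ * (unvec (y l))ᴴ) hB fun l => by
      rw [← quadForm_kronecker_eq_trace_right]
      exact quadForm_pos (hA'.kronecker hB) (hy l)
  have hJ : precisionCost M₁ M₂ c α₁ α₂ y A' B' ≤ precisionCost M₁ M₂ c α₁ α₂ y A B := by
    have e1 := precisionCost_eq_left (M₁ := M₁) (M₂ := M₂) (c := c) (α₁ := α₁) (α₂ := α₂)
      (y := y) A B
    have e2 := precisionCost_eq_left (M₁ := M₁) (M₂ := M₂) (c := c) (α₁ := α₁) (α₂ := α₂)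
      (y := y) A' B
    have e3 := precisionCost_eq_right (M₁ := M₁) (M₂ := M₂) (c := c) (α₁ := α₁) (α₂ := α₂)
      (y := y) A' B
    have e4 := precisionCost_eq_right (M₁ := M₁) (M₂ := M₂) (c := c) (α₁ := α₁) (α₂ := α₂)
      (y := y) A' B'
    linarith
  refine le_trans ?_ hJ
  rcases le_total (J (A', B')) J₁ with h | h
  · exact hle (A', B') (hmem A' B' hA' hB' htA' htB' h)
  · exact (hle (1, 1) h11).trans h

/-- The spread conditions make `precisionCost` coercive on normalized pairs. -/
lemma precisionCost_coercive (hL : 0 < L) (hNst : 0 < Nst) (hNp : 0 < Np)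
    (hrow : ∀ l j, (unvec (y l)).row j ≠ 0) (hcol : ∀ l i, (unvec (y l)).col i ≠ 0)
    (hα₁ : 0 ≤ α₁) (hα₂ : 0 ≤ α₂) {β₁ β₂ : ℝ} (hβ₁ : 0 ≤ β₁) (hβ₂ : 0 ≤ β₂) (hβ : β₁ + β₂ = 1)
    (hst : ∀ S : Submodule ℂ (Fin Nst → ℂ), S ≠ ⊥ → S ≠ ⊤ →
      SpreadBound L (Nst * Np) Np (Module.finrank ℂ S) α₁ β₁ β₂ (rowFraction y S))
    (hp : ∀ S : Submodule ℂ (Fin Np → ℂ), S ≠ ⊥ → S ≠ ⊤ →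
      SpreadBound L (Nst * Np) Nst (Module.finrank ℂ S) α₂ β₂ β₁ (colFraction y S)) :
    ∃ ε₁ > 0, ∃ ε₂ > 0, ∃ C : ℝ,
      ∀ (A : Matrix (Fin Nst) (Fin Nst) ℂ) (B : Matrix (Fin Np) (Fin Np) ℂ),
      A.PosDef → B.PosDef → A.trace = Nst → B.trace = Np →
      ∃ a b : ℝ, 0 < a ∧ a ≤ 1 ∧ 0 < b ∧ b ≤ 1 ∧
        (A - (a : ℂ) • (1 : Matrix (Fin Nst) (Fin Nst) ℂ)).PosSemidef ∧
        (B - (b : ℂ) • (1 : Matrix (Fin Np) (Fin Np) ℂ)).PosSemidef ∧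
        -ε₁ * Real.log a - ε₂ * Real.log b - C ≤
          precisionCost (Np + α₁) (Nst + α₂) ((Nst * Np : ℝ) / L) α₁ α₂ y A B := by
  classical
  have hL' : (0 : ℝ) < L := by exact_mod_cast hL
  have hn' : (0 : ℝ) < Nst := by exact_mod_cast hNst
  have hm' : (0 : ℝ) < Np := by exact_mod_cast hNp
  obtain ⟨ε₁, hε₁, C₁, h₁⟩ := factor_coercive hNst
    (T := Fin Np × Fin L) (fun t => (unvec (y t.2)).row t.1) (fun t => hrow t.2 t.1)
    -- The weight `w` is β₁ · (N / L) / Np, the share of one row; `b` is the coefficient of log a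
    -- received from the column bound; `κ` is then forced by β₁ + β₂ = 1.
    (M := Np + α₁) (w := β₁ * Nst / L) (b := β₂ * (Nst * Np)) (κ := α₁ * Nst)
    (by positivity) (by positivity) (by positivity)
    (fun S hS0 hS1 => by
      have h := hst S hS0 hS1
      rw [SpreadBound, rowFraction] at h
      rw [Fintype.sum_prod_type]
      push_cast at h
      refine lt_of_mul_lt_mul_left (a := (L : ℝ)) ?_ hL'.le
      refine lt_of_eq_of_lt ?_ (lt_of_lt_of_eq (add_lt_add_left h (β₂ * L * (Nst * Np))) ?_)
      · field_simp
      · ring)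
    (by
      rw [Fintype.card_prod, Fintype.card_fin, Fintype.card_fin]
      push_cast
      rw [← eq_sub_iff_add_eq] at hβ
      rw [hβ]
      field_simp
      ring)
  obtain ⟨ε₂, hε₂, C₂, h₂⟩ := factor_coercive hNp
    (T := Fin Nst × Fin L) (fun t => (unvec (y t.2)).col t.1) (fun t => hcol t.2 t.1)
    (M := Nst + α₂) (w := β₂ * Np / L) (b := β₁ * (Nst * Np)) (κ := α₂ * Np)
    (by positivity) (by positivity) (by positivity)
    (fun S hS0 hS1 => by
      have h := hp S hS0 hS1
      rw [SpreadBound, colFraction] at h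
      rw [Fintype.sum_prod_type]
      push_cast at h
      refine lt_of_mul_lt_mul_left (a := (L : ℝ)) ?_ hL'.le
      refine lt_of_eq_of_lt ?_ (lt_of_lt_of_eq (add_lt_add_left h (β₁ * L * (Nst * Np))) ?_)
      · field_simp
      · ring)
    (by
      rw [Fintype.card_prod, Fintype.card_fin, Fintype.card_fin]
      push_cast
      rw [← eq_sub_iff_add_eq] at hβ
      rw [hβ]
      field_simp
      ring)
  -- With the traces fixed, the penalties are the constants α₁ Nst and α₂ Np.
  refine ⟨ε₁, hε₁, ε₂, hε₂, C₁ + C₂ - α₁ * Nst - α₂ * Np, fun A B hA hB htA htB => ?_⟩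
  obtain ⟨a, ha, ha1, hAa, hfa⟩ := h₁ A hA htA
  obtain ⟨b, hb, hb1, hBb, hfb⟩ := h₂ B hB htB
  refine ⟨a, b, ha, ha1, hb, hb1, hAa, hBb, ?_⟩
  have hrows := Finset.sum_le_sum fun l (_ : l ∈ Finset.univ) =>
    log_quadForm_kronecker_ge_rows hNp hA hb hBb (hrow l)
  have hcols := Finset.sum_le_sum fun l (_ : l ∈ Finset.univ) =>
    log_quadForm_kronecker_ge_cols hNst hB ha hAa (hcol l)
  rw [Finset.sum_add_distrib, ← Finset.sum_div, Finset.sum_const, Finset.card_univ,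
    Fintype.card_fin, nsmul_eq_mul] at hrows hcols
  rw [Fintype.sum_prod_type, Finset.sum_comm] at hfa hfb
  simp only [precisionCost]
  set Q := ∑ l, Real.log (quadForm (A ⊗ₖ B) (y l)).re
  set R := ∑ l, ∑ j, Real.log (quadForm A ((unvec (y l)).row j)).re
  set D := ∑ l, ∑ i, Real.log (quadForm B ((unvec (y l)).col i)).re
  -- The data term is split in proportions β₁ and β₂ between the row and column bounds.
  have hQ : β₁ * Nst / L * R + β₁ * (Nst * Np) * Real.log b + (β₂ * Np / L * D
      + β₂ * (Nst * Np) * Real.log a) ≤ (Nst * Np : ℝ) / L * Q := by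
    have k1 := mul_le_mul_of_nonneg_left hrows
      (show (0 : ℝ) ≤ β₁ * (Nst * Np) / L by positivity)
    have k2 := mul_le_mul_of_nonneg_left hcols
      (show (0 : ℝ) ≤ β₂ * (Nst * Np) / L by positivity)
    have e1 : β₁ * (Nst * Np) / L * (L * Real.log b + R / Np) =
        β₁ * Nst / L * R + β₁ * (Nst * Np) * Real.log b := by
      field_simp
      ring
    have e2 : β₂ * (Nst * Np) / L * (L * Real.log a + D / Nst) =
        β₂ * Np / L * D + β₂ * (Nst * Np) * Real.log a := by
      field_simp
      ring
    have e3 : (Nst * Np : ℝ) / L * Q = β₁ * (Nst * Np) / L * Q + β₂ * (Nst * Np) / L * Q := by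
      rw [← eq_sub_iff_add_eq] at hβ
      rw [hβ]
      ring
    rw [e1] at k1
    rw [e2] at k2
    linarith
  rw [htA, htB, Complex.natCast_re, Complex.natCast_re]
  linarith

end RSKE

/-! ### Return to the covariance matrices -/

namespace RSKE

lemma penaltyWeight_nonneg (m : ℕ) {ρ : ℝ} (hρ : ρ ∈ Set.Ico (0 : ℝ) 1) :
    0 ≤ penaltyWeight m ρ :=
  div_nonneg (mul_nonneg (Nat.cast_nonneg m) hρ.1) (by linarith [hρ.2])

/-- The log-determinant weight exceeds `m` by exactly the penalty weight, which is the balance of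
degrees behind the rescaling argument. -/
lemma div_one_sub_eq_add_penaltyWeight (m : ℕ) {ρ : ℝ} (hρ : ρ < 1) :
    (m : ℝ) / (1 - ρ) = m + penaltyWeight m ρ := by
  have : 1 - ρ ≠ 0 := by linarith
  rw [penaltyWeight]
  field_simp
  ring

lemma log_det_inv {n : ℕ} {R : Matrix (Fin n) (Fin n) ℂ} (hR : R.PosDef) :
    Real.log R⁻¹.det.re = -Real.log R.det.re := by
  rw [Matrix.det_nonsing_inv, Ring.inverse_eq_inv', ← ofReal_re_of_pos hR.det_pos,
    ← Complex.ofReal_inv, Complex.ofReal_re, Real.log_inv, Complex.ofReal_re]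

lemma cost_eq_precisionCost {L Nst Np : ℕ} {ρst ρp : ℝ} (hρst : ρst < 1) (hρp : ρp < 1)
    (y : Fin L → Fin Nst × Fin Np → ℂ) {Rst : Matrix (Fin Nst) (Fin Nst) ℂ}
    {Rp : Matrix (Fin Np) (Fin Np) ℂ} (hRst : Rst.PosDef) (hRp : Rp.PosDef) :
    cost ρst ρp y Rst Rp =
      precisionCost (Np + penaltyWeight Np ρst) (Nst + penaltyWeight Nst ρp)
        ((Nst * Np : ℝ) / L) (penaltyWeight Np ρst) (penaltyWeight Nst ρp) y Rst⁻¹ Rp⁻¹ := by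
  rw [cost, precisionCost, log_det_inv hRst, log_det_inv hRp, Matrix.inv_kronecker,
    div_one_sub_eq_add_penaltyWeight Np hρst, div_one_sub_eq_add_penaltyWeight Nst hρp]
  push_cast
  ring

/-- The stationarity equation, divided by its leading coefficient. -/
lemma eq_of_stationary {n m L : ℕ} (hm : 0 < m) {ρ c : ℝ} (hρ : ρ < 1)
    (hc : c = (n : ℝ) * m / L) {X Z : Matrix (Fin n) (Fin n) ℂ}
    (h : ((m + penaltyWeight m ρ : ℝ) : ℂ) • X = (c : ℂ) • Z + (penaltyWeight m ρ : ℂ) • 1) :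
    X = ((1 - (ρ : ℂ)) * ((n : ℂ) / L)) • Z + (ρ : ℂ) • 1 := by
  have hm' : (m : ℝ) ≠ 0 := by exact_mod_cast hm.ne'
  have hρ' : 1 - ρ ≠ 0 := by linarith
  have e1 : (1 - ρ) / m * (m + penaltyWeight m ρ) = 1 := by
    rw [← div_one_sub_eq_add_penaltyWeight m hρ]
    field_simp
  have e2 : (1 - ρ) / m * c = (1 - ρ) * (n / L) := by
    rw [hc]
    field_simp
  have e3 : (1 - ρ) / m * penaltyWeight m ρ = ρ := by
    rw [penaltyWeight]
    field_simp
  have h' := congrArg ((((1 - ρ) / m : ℝ) : ℂ) • ·) h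
  simp only [smul_add, smul_smul, ← Complex.ofReal_mul, e1, e2, e3] at h'
  simpa using h'

end RSKE

theorem proposition1 {L Nst Np : ℕ} (hL : 0 < L) (hNst : 0 < Nst) (hNp : 0 < Np)
    (ρst ρp : ℝ) (hρst : ρst ∈ Set.Ico (0 : ℝ) 1) (hρp : ρp ∈ Set.Ico (0 : ℝ) 1)
    (y : Fin L → Fin Nst × Fin Np → ℂ)
    (hrow : ∀ l j, (RSKE.unvec (y l)).row j ≠ 0)
    (hcol : ∀ l i, (RSKE.unvec (y l)).col i ≠ 0)
    (hspread : ∃ β₁ ∈ Set.Icc (0 : ℝ) 1, ∃ β₂ ∈ Set.Icc (0 : ℝ) 1, β₁ + β₂ = 1 ∧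
      (∀ S : Submodule ℂ (Fin Nst → ℂ), S ≠ ⊥ → S ≠ ⊤ →
        RSKE.SpreadBound L (Nst * Np) Np (Module.finrank ℂ S)
          (RSKE.penaltyWeight Np ρst) β₁ β₂ (RSKE.rowFraction y S)) ∧
      (∀ S : Submodule ℂ (Fin Np → ℂ), S ≠ ⊥ → S ≠ ⊤ →
        RSKE.SpreadBound L (Nst * Np) Nst (Module.finrank ℂ S)
          (RSKE.penaltyWeight Nst ρp) β₂ β₁ (RSKE.colFraction y S))) :
    (∃ c : ℝ, ∀ (Rst : Matrix (Fin Nst) (Fin Nst) ℂ) (Rp : Matrix (Fin Np) (Fin Np) ℂ),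
      Rst.PosDef → Rp.PosDef → c ≤ RSKE.cost ρst ρp y Rst Rp) ∧
    (∃ (Rst : Matrix (Fin Nst) (Fin Nst) ℂ) (Rp : Matrix (Fin Np) (Fin Np) ℂ),
      Rst.PosDef ∧ Rp.PosDef ∧ RSKE.IsFixedPoint ρst ρp y Rst Rp) := by
  obtain ⟨β₁, hβ₁, β₂, hβ₂, hβ, hst, hp⟩ := hspread
  have hL' : (L : ℝ) ≠ 0 := by exact_mod_cast hL.ne'
  have hα₁ := RSKE.penaltyWeight_nonneg Np hρst
  have hα₂ := RSKE.penaltyWeight_nonneg Nst hρp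
  have hy : ∀ l, y l ≠ 0 := fun l h => hrow l ⟨0, hNp⟩ (by
    ext i
    simp [h, RSKE.unvec, Matrix.row])
  obtain ⟨ε₁, hε₁, ε₂, hε₂, C, hcoer⟩ := RSKE.precisionCost_coercive hL hNst hNp hrow hcol
    hα₁ hα₂ hβ₁.1 hβ₂.1 hβ hst hp
  obtain ⟨A, B, hA, hB, hmin⟩ := RSKE.exists_minimizer_precisionCost hNst hNp hy hα₁ hα₂
    (by field_simp) (by field_simp) hε₁ hε₂ hcoer
  -- The lower bound left to unification is the minimum value of `precisionCost`.
  refine ⟨⟨_, fun Rst Rp hRst hRp => (hmin _ _ hRst.inv hRp.inv).trans_eq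
    (RSKE.cost_eq_precisionCost hρst.2 hρp.2 y hRst hRp).symm⟩, A⁻¹, B⁻¹, hA.inv, hB.inv, ?_⟩
  · have hAA : A⁻¹⁻¹ = A := Matrix.nonsing_inv_nonsing_inv A
      (isUnit_iff_ne_zero.2 hA.det_pos.ne')
    have hBB : B⁻¹⁻¹ = B := Matrix.nonsing_inv_nonsing_inv B
      (isUnit_iff_ne_zero.2 hB.det_pos.ne')
    have hpos : ∀ l, 0 < RSKE.quadForm (A ⊗ₖ B) (y l) := fun l =>
      RSKE.quadForm_pos (hA.kronecker hB) (hy l)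
    rw [RSKE.IsFixedPoint, hAA, hBB]
    constructor
    · refine RSKE.eq_of_stationary hNp hρst.2 rfl ?_
      simp only [RSKE.quadForm_kronecker_eq_trace_left] at hpos ⊢
      -- A joint minimizer minimizes in `A` alone when `B` is frozen, and the terms in `B` only
      -- cancel.
      refine RSKE.factorCost_stationary hA (fun l => ?_) hpos fun A' hA' => ?_
      · exact (hB.posSemidef.conjTranspose_mul_mul_same _).transpose.isHermitian
      · have h := hmin A' B hA' hB
        rw [RSKE.precisionCost_eq_left, RSKE.precisionCost_eq_left] at h
        linarith
    · refine RSKE.eq_of_stationary hNst hρp.2 (by rw [mul_comm]) ?_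
      simp only [RSKE.quadForm_kronecker_eq_trace_right] at hpos ⊢
      refine RSKE.factorCost_stationary hB (fun l => ?_) hpos fun B' hB' => ?_
      · exact (hA.transpose.posSemidef.mul_mul_conjTranspose_same _).isHermitian
      · have h := hmin A B' hA hB'
        rw [RSKE.precisionCost_eq_right, RSKE.precisionCost_eq_right] at h
        linarith
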